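/- All logarithms $\log$ are to base 2, $\log^* n$ is the number of times $\log$ must be applied to $n$ to reach a value at most $1$, and $\alpha=\alpha(G)$ is the arboricity of $G$, the least number of forests into which $E(G)$ can be partitioned. In the LOCAL model, every vertex of the input graph hosts a processor, which initially knows its own identifier, the identifiers of its neighbours, the global parameters, and a private random seed, independent of the other seeds. The identifiers are distinct integers in $\{0,\dots,n^q-1\}$ for a constant $q$. Computation proceeds in synchronous rounds, in each of which a processor may send a message of arbitrary length to each neighbour, and local computation is unbounded. The number of rounds of an execution is the number of rounds until all processors have halted with an output. **Theorem.** For all constants $K$, $D$, $c\ge 1$, $q,d\in\mathbb N$ there are a constant $C>0$ and a randomized LOCAL algorithm that is given $n\ge 2$, a real number $a$ and a real number $t$, such that the following holds for every $n$-vertex graph $G$ with at least one edge and every $a$ with $a\le c\,\alpha$ and $\alpha\le c\,a$ (an estimate of the arboricity up to a constant factor). (i) If $2<t\le K\sqrt{n/\log n}$, then the algorithm always produces a proper colouring of $G$ with at most $C\,t\,\alpha\log n$ colours, and its number of rounds is at most $C(\log_t n+\log^* n)$, both in expectation and with probability at least $1-n^{-d}$. (ii) If $k>0$ is a real number with $2<n^{1/k}\le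 K\sqrt{n/\log n}$, then the algorithm with $t=n^{1/k}$ always produces a proper colouring of $G$ with at most $C\,\alpha\, n^{1/k}\log n$ colours, and its number of rounds is at most $C(k+\log^* n)$, both in expectation and with probability at least $1-n^{-d}$. If moreover $\log^* n\le D\,k$ (which covers the regime $k=\omega(\sqrt{\log n})$), then its number of rounds is at most $C\,k$, both in expectation and with probability at least $1-n^{-d}$. -/

import Mathlib

open scoped ENNReal

noncomputable section

/-- The arboricity of a graph: the least `r` such that the edge set can be partitioned
into `r` forests. -/
def SimpleGraph.arboricity {V : Type*} (G : SimpleGraph V) : ℕ :=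
  sInf {r : ℕ | ∃ F : Fin r → SimpleGraph V,
    (∀ i, (F i).IsAcyclic) ∧
    (∀ i j, i ≠ j → Disjoint (F i).edgeSet (F j).edgeSet) ∧
    (⋃ i, (F i).edgeSet) = G.edgeSet}

/-- The iterated logarithm: the least `i` such that applying `log₂` to `n` exactly `i` times
gives a value that is at most `1`. -/
def logStar (n : ℕ) : ℕ :=
  sInf {i : ℕ | (Real.logb 2)^[i] (n : ℝ) ≤ 1}

/-- A randomized algorithm in the LOCAL model that outputs natural numbers (colours).
All nodes run the same code. Local computation and message length are unbounded.
Global parameters known to all nodes are arguments of a family of such algorithms.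

* At the start, a node knows its own identifier, the set of the identifiers of its neighbours,
  and a private random seed, uniformly distributed in the finite type `Seed`, independent of
  the seeds of the other nodes.
* In each round, a node in state `s` sends the message `send s i` to its neighbour with
  identifier `i`; it then receives the set of all pairs (identifier of the sender, message)
  sent to it, and updates its state by `recv`.
* A node halts, with output `c`, as soon as its state `s` satisfies `output s = some c`. -/
structure LocalAlgorithm where
  Seed : Type
  State : Type
  Msg : Type
  [seedFintype : Fintype Seed]
  [seedNonempty : Nonempty Seed]
  init : (ident : ℕ) → (neighbours : Set ℕ) → Seed → State
  send : State → ℕ → Msg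
  recv : State → Set (ℕ × Msg) → State
  output : State → Option ℕ

namespace LocalAlgorithm

attribute [instance] LocalAlgorithm.seedFintype LocalAlgorithm.seedNonempty

variable {V : Type} (A : LocalAlgorithm) (G : SimpleGraph V) (ident : V → ℕ)

/-- The messages that node `v` receives in a round that starts in the configuration `σ`,
each with the identifier of its sender. Halted nodes are silent. -/
def inbox (σ : V → A.State) (v : V) : Set (ℕ × A.Msg) :=
  {x | ∃ u, G.Adj v u ∧ A.output (σ u) = none ∧ x = (ident u, A.send (σ u) (ident v))}

/-- One synchronous round. Halted nodes keep their state, so that outputs are irrevocable. -/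
def step (σ : V → A.State) (v : V) : A.State :=
  match A.output (σ v) with
  | some _ => σ v
  | none => A.recv (σ v) (A.inbox G ident σ v)

/-- The configuration after `r` rounds, when node `v` has the random seed `ρ v`. -/
def config (ρ : V → A.Seed) (r : ℕ) : V → A.State :=
  (A.step G ident)^[r] (fun v => A.init (ident v) (ident '' G.neighborSet v) (ρ v))

/-- The number of rounds of the execution with random seeds `ρ`: the first round after which
all nodes have halted, and `∞` if there is none. -/
def rounds (ρ : V → A.Seed) : ℝ≥0∞ :=
  ⨅ (r : ℕ) (_ : ∀ v, A.output (A.config G ident ρ r v) ≠ none), (r : ℝ≥0∞)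

/-- In the execution with random seeds `ρ` all nodes eventually halt, and their outputs are a
proper colouring of `G` with the palette `{0, …, p - 1}`. -/
def ProducesColoring (ρ : V → A.Seed) (p : ℕ) : Prop :=
  ∃ (r : ℕ) (f : G.Coloring (Fin p)),
    ∀ v, A.output (A.config G ident ρ r v) = some (f v : ℕ)

/-- The expected number of rounds: the average over all assignments of seeds to the nodes. -/
def expectedRounds [Fintype V] [DecidableEq V] : ℝ≥0∞ :=
  (∑ ρ : V → A.Seed, A.rounds G ident ρ) / (Fintype.card (V → A.Seed) : ℝ≥0∞)

/-- The probability of an event, over independent uniformly distributed seeds of the nodes. -/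
def prob (E : Set (V → A.Seed)) : ℝ :=
  (E.ncard : ℝ) / (Nat.card (V → A.Seed) : ℝ)

/-- On the graph `G` with the given identifiers, the algorithm always produces a proper
`p`-colouring; the number of rounds is at most `T` in expectation, and it is at most `T`
with probability at least `1 - δ`. -/
def Colors [Fintype V] [DecidableEq V] (p : ℕ) (T δ : ℝ) : Prop :=
  (∀ ρ : V → A.Seed, A.ProducesColoring G ident ρ p) ∧
  A.expectedRounds G ident ≤ ENNReal.ofReal T ∧
  1 - δ ≤ A.prob {ρ : V → A.Seed | A.rounds G ident ρ ≤ ENNReal.ofReal T}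

end LocalAlgorithm

end

/-!
Write `α` for the arboricity. A set of vertices induces at most `α` times as many edges as it has
vertices, so at most a fraction `1 / √t` of its vertices have `2 * α * √t` or more neighbours
inside it. Hence `O(log_t n)` rounds of peeling off the other vertices exhaust the graph, and every
vertex has fewer than `O(α * √t)` neighbours in its own level. All levels are then coloured
simultaneously, each with its own palette of `O(α * t)` colours: a random trial of an uncoloured
vertex collides with a neighbour of the same level with probability at most `1 / √t`, and
`O(log_t n)` trials suffice with high probability. The rare executions in which they do not are
finished greedily in at most `n` further rounds, which is negligible in expectation.
-/

section Arboricity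

open SimpleGraph

variable {V : Type*}

lemma card_edgeFinset_le_of_isAcyclic [Fintype V] {F : SimpleGraph V} [Fintype F.edgeSet]
    (hF : F.IsAcyclic) : F.edgeFinset.card ≤ Fintype.card V := by
  classical
  rcases isEmpty_or_nonempty V with _ | _
  · simp [Finset.eq_empty_of_isEmpty]
  · obtain ⟨T, hFT, -, hT⟩ :=
      (connected_top (V := V)).exists_isTree_le_of_le_of_isAcyclic le_top hF
    calc F.edgeFinset.card ≤ T.edgeFinset.card := Finset.card_le_card (edgeFinset_mono hFT)
      _ ≤ Fintype.card V := by have := hT.card_edgeFinset; lia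

lemma isAcyclic_fromEdgeSet_singleton (e : Sym2 V) : (fromEdgeSet {e}).IsAcyclic := by
  induction e with | h u v =>
  rcases eq_or_ne u v with rfl | huv
  · rw [← edge, edge_self_eq_bot]
    exact isAcyclic_bot
  · simpa [edge] using isAcyclic_bot.sup_edge_of_not_reachable (mt reachable_bot.1 huv)

lemma exists_forest_partition [Finite V] (G : SimpleGraph V) :
    ∃ F : Fin G.arboricity → SimpleGraph V,
      (∀ i, (F i).IsAcyclic) ∧
      (∀ i j, i ≠ j → Disjoint (F i).edgeSet (F j).edgeSet) ∧
      (⋃ i, (F i).edgeSet) = G.edgeSet := by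
  refine Nat.sInf_mem (s := {r : ℕ | ∃ F : Fin r → SimpleGraph V,
    (∀ i, (F i).IsAcyclic) ∧
    (∀ i j, i ≠ j → Disjoint (F i).edgeSet (F j).edgeSet) ∧
    (⋃ i, (F i).edgeSet) = G.edgeSet}) ?_
  obtain ⟨r, ⟨enum⟩⟩ := Finite.exists_equiv_fin G.edgeSet
  have edgeSet_single : ∀ i, (fromEdgeSet {(enum.symm i : Sym2 V)}).edgeSet =
      {(enum.symm i : Sym2 V)} := fun i => by
    rw [edgeSet_fromEdgeSet, sdiff_eq_left, Set.disjoint_singleton_left]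
    exact G.not_isDiag_of_mem_edgeSet (enum.symm i).2
  refine ⟨r, fun i => fromEdgeSet {(enum.symm i : Sym2 V)},
    fun i => isAcyclic_fromEdgeSet_singleton _, fun i j hij => ?_, ?_⟩
  · rw [edgeSet_single, edgeSet_single, Set.disjoint_singleton]
    exact fun h => hij (enum.symm.injective (Subtype.ext h))
  · simp only [edgeSet_single, Set.iUnion_singleton_eq_range]
    exact (enum.symm.surjective.range_comp _).trans Subtype.range_coe

lemma arboricity_pos [Finite V] {G : SimpleGraph V} (hG : G ≠ ⊥) : 0 < G.arboricity := by
  by_contra! h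
  obtain ⟨F, -, -, hF⟩ := exists_forest_partition G
  have : IsEmpty (Fin G.arboricity) := by
    rw [Nat.le_zero.1 h]
    infer_instance
  rw [Set.iUnion_of_empty] at hF
  exact hG (edgeSet_eq_empty.1 hF.symm)

lemma sum_ncard_neighborSet_inter_le_of_isAcyclic {F : SimpleGraph V} (hF : F.IsAcyclic)
    (S : Finset V) : ∑ v ∈ S, (F.neighborSet v ∩ S).ncard ≤ 2 * S.card := by
  classical
  have degree_induce : ∀ v : S,
      (F.neighborSet v ∩ S).ncard = (F.induce (S : Set V)).degree v := fun v => by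
    rw [← card_neighborFinset_eq_degree, ← Set.ncard_coe_finset,
      ← Set.ncard_image_of_injective _ Subtype.val_injective]
    congr 1
    ext u
    simp [and_comm]
  calc ∑ v ∈ S, (F.neighborSet v ∩ S).ncard
      = ∑ v : S, (F.induce (S : Set V)).degree v := by
        rw [← Finset.sum_coe_sort]
        exact Finset.sum_congr rfl fun v _ => degree_induce v
    _ = 2 * (F.induce (S : Set V)).edgeFinset.card := sum_degrees_eq_twice_card_edges _
    _ ≤ 2 * S.card := by
        simpa using card_edgeFinset_le_of_isAcyclic (hF.induce (S : Set V))

lemma sum_ncard_neighborSet_inter_le [Finite V] (G : SimpleGraph V) (S : Finset V) :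
    ∑ v ∈ S, (G.neighborSet v ∩ S).ncard ≤ 2 * G.arboricity * S.card := by
  obtain ⟨F, hF, -, hFG⟩ := exists_forest_partition G
  have neighborSet_eq : ∀ v, G.neighborSet v ∩ S = ⋃ i, (F i).neighborSet v ∩ S := fun v => by
    ext u
    simp [← mem_edgeSet, ← hFG]
  calc ∑ v ∈ S, (G.neighborSet v ∩ S).ncard
      ≤ ∑ v ∈ S, ∑ i, ((F i).neighborSet v ∩ S).ncard :=
        Finset.sum_le_sum fun v _ => by
          rw [neighborSet_eq]
          exact Set.ncard_iUnion_le_of_fintype _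
    _ = ∑ i, ∑ v ∈ S, ((F i).neighborSet v ∩ S).ncard := Finset.sum_comm
    _ ≤ ∑ _i : Fin G.arboricity, 2 * S.card :=
        Finset.sum_le_sum fun i _ => sum_ncard_neighborSet_inter_le_of_isAcyclic (hF i) S
    _ = 2 * G.arboricity * S.card := by
        rw [Fin.sum_const, smul_eq_mul]
        ring

lemma card_high_degree_mul_le [Finite V] (G : SimpleGraph V) {S T : Finset V} (hTS : T ⊆ S)
    {D : ℕ} (hT : ∀ v ∈ T, D < (G.neighborSet v ∩ S).ncard) :
    T.card * (D + 1) ≤ 2 * G.arboricity * S.card :=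
  calc T.card * (D + 1) ≤ ∑ v ∈ T, (G.neighborSet v ∩ S).ncard := T.card_nsmul_le_sum _ (D + 1) hT
    _ ≤ ∑ v ∈ S, (G.neighborSet v ∩ S).ncard := Finset.sum_le_sum_of_subset hTS
    _ ≤ 2 * G.arboricity * S.card := sum_ncard_neighborSet_inter_le G S

end Arboricity

section Peeling

variable {V : Type*}

open Classical in
/-- The H-partition of `G` with degree threshold `D`, after `τ` rounds of peeling. In each round
the vertices with at most `D` neighbours among the surviving ones are removed. The level of a
removed vertex is the round of its removal, and the level of a surviving vertex is `τ`. -/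
noncomputable def peelLevel (G : SimpleGraph V) (D : ℕ) : ℕ → V → ℕ
  | 0, _ => 0
  | τ + 1, v =>
    if peelLevel G D τ v = τ ∧ D < (G.neighborSet v ∩ {u | peelLevel G D τ u = τ}).ncard then τ + 1
    else peelLevel G D τ v

variable {G : SimpleGraph V} {D : ℕ}

lemma peelLevel_le (τ : ℕ) (v : V) : peelLevel G D τ v ≤ τ := by
  induction τ with
  | zero => rfl
  | succ τ ih =>
    rw [peelLevel]
    split_ifs <;> lia

lemma peelLevel_succ_eq_succ_iff {τ : ℕ} {v : V} :
    peelLevel G D (τ + 1) v = τ + 1 ↔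
      peelLevel G D τ v = τ ∧ D < (G.neighborSet v ∩ {u | peelLevel G D τ u = τ}).ncard := by
  have := peelLevel_le (G := G) (D := D) τ v
  rw [peelLevel]
  split_ifs with h
  · simp [h]
  · simp only [h, iff_false]
    lia

lemma peelLevel_succ_of_ne {τ : ℕ} {v : V} (h : peelLevel G D (τ + 1) v ≠ τ + 1) :
    peelLevel G D (τ + 1) v = peelLevel G D τ v := by
  rw [peelLevel, if_neg (mt peelLevel_succ_eq_succ_iff.2 h)]

lemma ncard_neighborSet_inter_peelLevel_ge_le [Finite V] {τ : ℕ} {v : V}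
    (hv : peelLevel G D τ v < τ) :
    (G.neighborSet v ∩ {u | peelLevel G D τ v ≤ peelLevel G D τ u}).ncard ≤ D := by
  induction τ with
  | zero => lia
  | succ τ ih =>
    have level_v := peelLevel_succ_of_ne hv.ne
    have level_mono : {u | peelLevel G D (τ + 1) v ≤ peelLevel G D (τ + 1) u} ⊆
        {u | peelLevel G D τ v ≤ peelLevel G D τ u} := by
      intro u (hu : peelLevel G D (τ + 1) v ≤ peelLevel G D (τ + 1) u)
      change peelLevel G D τ v ≤ peelLevel G D τ u
      by_cases hu' : peelLevel G D (τ + 1) u = τ + 1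
      · rw [(peelLevel_succ_eq_succ_iff.1 hu').1]
        exact peelLevel_le τ v
      · rwa [← level_v, ← peelLevel_succ_of_ne hu']
    refine (Set.ncard_le_ncard (Set.inter_subset_inter_right _ level_mono)).trans ?_
    rcases (peelLevel_le τ v).lt_or_eq with hlt | heq
    · exact ih hlt
    · have survivors : {u | τ ≤ peelLevel G D τ u} = {u | peelLevel G D τ u = τ} :=
        Set.ext fun u => ⟨fun hu => (peelLevel_le τ u).antisymm hu, fun hu => hu.ge⟩
      rw [heq, survivors]
      exact not_lt.1 fun h => hv.ne (peelLevel_succ_eq_succ_iff.2 ⟨heq, h⟩)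

lemma card_peelLevel_eq_mul_pow_le [Fintype V] {s : ℝ} (hs : 0 ≤ s)
    (hD : 2 * G.arboricity * s ≤ D + 1) (τ : ℕ) :
    ((Finset.univ.filter fun v => peelLevel G D τ v = τ).card : ℝ) * s ^ τ ≤ Fintype.card V := by
  induction τ with
  | zero => simp [peelLevel]
  | succ τ ih =>
    set S := Finset.univ.filter fun v => peelLevel G D τ v = τ with hS
    set T := Finset.univ.filter fun v => peelLevel G D (τ + 1) v = τ + 1 with hT
    have survivors_mul : (T.card : ℝ) * (D + 1) ≤ 2 * G.arboricity * S.card := by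
      exact_mod_cast card_high_degree_mul_le G (S := S) (T := T)
        (fun v hv => by
          simp only [hT, hS, Finset.mem_filter_univ] at hv ⊢
          exact (peelLevel_succ_eq_succ_iff.1 hv).1)
        (fun v hv => by
          simp only [hT, hS, Finset.mem_filter_univ, Finset.coe_filter_univ] at hv ⊢
          exact (peelLevel_succ_eq_succ_iff.1 hv).2)
    have shrink : (T.card : ℝ) * s ≤ S.card := by
      refine le_of_mul_le_mul_right ?_ (by positivity : (0 : ℝ) < D + 1)
      calc (T.card : ℝ) * s * (D + 1) = T.card * (D + 1) * s := by ring
        _ ≤ 2 * G.arboricity * S.card * s := by gcongr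
        _ = S.card * (2 * G.arboricity * s) := by ring
        _ ≤ S.card * (D + 1) := by gcongr
    calc (T.card : ℝ) * s ^ (τ + 1) = T.card * s * s ^ τ := by ring
      _ ≤ S.card * s ^ τ := by gcongr
      _ ≤ Fintype.card V := ih

lemma peelLevel_lt [Fintype V] {s : ℝ} (hs : 0 ≤ s) (hD : 2 * G.arboricity * s ≤ D + 1) {L : ℕ}
    (hL : Fintype.card V < s ^ L) (v : V) : peelLevel G D L v < L := by
  refine (peelLevel_le L v).lt_of_ne fun hv => hL.not_ge ?_
  have survivor : 1 ≤ (Finset.univ.filter fun v => peelLevel G D L v = L).card :=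
    Finset.card_pos.2 ⟨v, by simpa using hv⟩
  calc s ^ L ≤ (Finset.univ.filter fun v => peelLevel G D L v = L).card * s ^ L :=
        le_mul_of_one_le_left (by positivity) (by exact_mod_cast survivor)
    _ ≤ Fintype.card V := card_peelLevel_eq_mul_pow_le hs hD L

/-- The subgraph of `G` formed by the edges within the classes of `ℓ`. -/
def levelGraph (G : SimpleGraph V) (ℓ : V → ℕ) : SimpleGraph V where
  Adj u v := G.Adj u v ∧ ℓ u = ℓ v
  symm := ⟨fun _ _ h => ⟨h.1.symm, h.2.symm⟩⟩
  loopless := ⟨fun _ h => h.1.ne rfl⟩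

lemma ncard_neighborSet_levelGraph_peelLevel_le [Finite V] {L : ℕ} {v : V}
    (hv : peelLevel G D L v < L) :
    ((levelGraph G (peelLevel G D L)).neighborSet v).ncard ≤ D :=
  (Set.ncard_le_ncard fun _ hu => Set.mem_inter hu.1 hu.2.le).trans
    (ncard_neighborSet_inter_peelLevel_ge_le hv)

end Peeling

section ColouringProcess

variable {V : Type*}

/-- The colours fixed so far form a proper partial colouring. -/
def IsPartialColouring (H : SimpleGraph V) (col : V → Option ℕ) : Prop :=
  ∀ ⦃u v⦄, H.Adj u v → ∀ c, col u = some c → col v ≠ some c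

open Classical in
/-- One round of random trials: an uncoloured vertex keeps its trial colour `x v` unless a
neighbour has fixed that colour or is trying it at the same time. -/
noncomputable def trialStep (H : SimpleGraph V) (x : V → ℕ) (col : V → Option ℕ) (v : V) :
    Option ℕ :=
  if col v = none ∧ ∀ u, H.Adj v u → (col u).getD (x u) ≠ x v then some (x v) else col v

/-- The least colour that no neighbour of `v` has fixed. -/
noncomputable def greedyColour (H : SimpleGraph V) (col : V → Option ℕ) (v : V) : ℕ :=
  sInf {c | ∀ u, H.Adj v u → col u ≠ some c}

open Classical in
/-- One round of the greedy clean-up: the uncoloured vertices whose identifier is smaller than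
those of all uncoloured neighbours take their greedy colour. -/
noncomputable def greedyStep (H : SimpleGraph V) (ident : V → ℕ) (col : V → Option ℕ) (v : V) :
    Option ℕ :=
  if col v = none ∧ ∀ u, H.Adj v u → col u = none → ident v < ident u then
    some (greedyColour H col v)
  else col v

/-- The partial colouring after a number of rounds: first `M` rounds of random trials, in which
vertex `v` tries the colours `ρ v 0, …, ρ v (M - 1)`, then rounds of the greedy clean-up. -/
noncomputable def colourRun (H : SimpleGraph V) (ident : V → ℕ) {M p : ℕ}
    (ρ : V → Fin M → Fin (p + 1)) : ℕ → V → Option ℕ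
  | 0 => fun _ => none
  | j + 1 =>
    if h : j < M then trialStep H (fun u => ρ u ⟨j, h⟩) (colourRun H ident ρ j)
    else greedyStep H ident (colourRun H ident ρ j)

variable {H : SimpleGraph V} {ident : V → ℕ} {col : V → Option ℕ} {x : V → ℕ} {v : V}

lemma trialStep_eq_some {c : ℕ} (h : trialStep H x col v = some c) :
    col v = some c ∨
      col v = none ∧ x v = c ∧ ∀ u, H.Adj v u → (col u).getD (x u) ≠ x v := by
  rw [trialStep] at h
  split_ifs at h with hv
  · exact .inr ⟨hv.1, Option.some.inj h, hv.2⟩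
  · exact .inl h

lemma greedyStep_eq_some {c : ℕ} (h : greedyStep H ident col v = some c) :
    col v = some c ∨ col v = none ∧ greedyColour H col v = c ∧
      ∀ u, H.Adj v u → col u = none → ident v < ident u := by
  rw [greedyStep] at h
  split_ifs at h with hv
  · exact .inr ⟨hv.1, Option.some.inj h, hv.2⟩
  · exact .inl h

lemma trialStep_of_ne_none (h : col v ≠ none) : trialStep H x col v = col v :=
  if_neg fun h' => h h'.1

lemma greedyStep_of_ne_none (h : col v ≠ none) : greedyStep H ident col v = col v :=
  if_neg fun h' => h h'.1

lemma IsPartialColouring.trialStep (h : IsPartialColouring H col) :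
    IsPartialColouring H (trialStep H x col) := by
  intro u v huv c hu hv
  rcases trialStep_eq_some hu with hu | ⟨-, rfl, hu'⟩ <;>
    rcases trialStep_eq_some hv with hv | ⟨hv, hvc, hv'⟩
  · exact h huv c hu hv
  · exact hv' u huv.symm (by simp [hu, hvc])
  · exact hu' v huv (by simp [hv])
  · exact hu' v huv (by simp [hv, hvc])

lemma exists_le_forall_ne_some [Finite V] (H : SimpleGraph V) (col : V → Option ℕ) (v : V) :
    ∃ c ≤ (H.neighborSet v).ncard, ∀ u, H.Adj v u → col u ≠ some c := by
  by_contra! taken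
  have subset : Set.Iic (H.neighborSet v).ncard ⊆ (fun u => (col u).getD 0) '' H.neighborSet v := by
    intro c hc
    obtain ⟨u, hu, huc⟩ := taken c hc
    exact ⟨u, hu, by simp [huc]⟩
  have := (Set.ncard_le_ncard subset).trans (Set.ncard_image_le (Set.toFinite _))
  rw [Set.ncard_Iic_nat] at this
  lia

lemma greedyColour_le [Finite V] : greedyColour H col v ≤ (H.neighborSet v).ncard := by
  obtain ⟨c, hc, hfree⟩ := exists_le_forall_ne_some H col v
  exact (Nat.sInf_le (s := {c | ∀ u, H.Adj v u → col u ≠ some c}) hfree).trans hc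

lemma ne_some_greedyColour [Finite V] {u : V} (h : H.Adj v u) :
    col u ≠ some (greedyColour H col v) := by
  obtain ⟨c, -, hfree⟩ := exists_le_forall_ne_some H col v
  exact Nat.sInf_mem (s := {c | ∀ u, H.Adj v u → col u ≠ some c}) ⟨c, hfree⟩ u h

lemma IsPartialColouring.greedyStep [Finite V] (h : IsPartialColouring H col) :
    IsPartialColouring H (greedyStep H ident col) := by
  intro u v huv c hu hv
  rcases greedyStep_eq_some hu with hu | ⟨hu, huc, hu'⟩ <;>
    rcases greedyStep_eq_some hv with hv | ⟨hv, hvc, hv'⟩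
  · exact h huv c hu hv
  · exact ne_some_greedyColour huv.symm (hvc ▸ hu)
  · exact ne_some_greedyColour huv (huc ▸ hv)
  · exact (hu' v huv hv).asymm (hv' u huv.symm hu)

lemma ncard_greedyStep_eq_none_le [Finite V] (hident : ident.Injective) :
    {v | greedyStep H ident col v = none}.ncard ≤ {v | col v = none}.ncard - 1 := by
  have subset : {v | greedyStep H ident col v = none} ⊆ {v | col v = none} := fun v hv => by
    by_contra h
    exact h ((greedyStep_of_ne_none h).symm.trans hv)
  rcases {v | col v = none}.eq_empty_or_nonempty with hempty | hne
  · simp [Set.subset_empty_iff.1 (hempty ▸ subset)]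
  · obtain ⟨v, hv, hmin⟩ := Set.exists_min_image _ ident (Set.toFinite _) hne
    refine Nat.le_sub_one_of_lt (Set.ncard_lt_ncard (subset.ssubset_of_mem_notMem hv ?_))
    have first : col v = none ∧ ∀ u, H.Adj v u → col u = none → ident v < ident u :=
      ⟨hv, fun u hu hu' => (hmin u hu').lt_of_ne (hident.ne hu.ne)⟩
    simp [greedyStep, if_pos first]

variable {M p : ℕ} {ρ : V → Fin M → Fin (p + 1)} {j : ℕ}

lemma colourRun_succ_of_lt (h : j < M) :
    colourRun H ident ρ (j + 1) = trialStep H (fun u => ρ u ⟨j, h⟩) (colourRun H ident ρ j) :=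
  dif_pos h

lemma colourRun_succ_of_le (h : M ≤ j) :
    colourRun H ident ρ (j + 1) = greedyStep H ident (colourRun H ident ρ j) :=
  dif_neg h.not_gt

lemma isPartialColouring_colourRun [Finite V] (j : ℕ) :
    IsPartialColouring H (colourRun H ident ρ j) := by
  induction j with
  | zero => simp [IsPartialColouring, colourRun]
  | succ j ih =>
    rcases lt_or_ge j M with h | h
    · rw [colourRun_succ_of_lt h]
      exact ih.trialStep
    · rw [colourRun_succ_of_le h]
      exact ih.greedyStep

lemma colourRun_succ_of_ne_none (hv : colourRun H ident ρ j v ≠ none) :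
    colourRun H ident ρ (j + 1) v = colourRun H ident ρ j v := by
  rcases lt_or_ge j M with h | h
  · rw [colourRun_succ_of_lt h, trialStep_of_ne_none hv]
  · rw [colourRun_succ_of_le h, greedyStep_of_ne_none hv]

lemma colourRun_eq_none_of_le {i : ℕ} (hij : i ≤ j) (hv : colourRun H ident ρ j v = none) :
    colourRun H ident ρ i v = none := by
  induction j, hij using Nat.le_induction with
  | base => exact hv
  | succ j _ ih =>
    refine ih (by_contra fun h => h ?_)
    rwa [← colourRun_succ_of_ne_none h]

lemma colourRun_le [Finite V] (hp : ∀ v, (H.neighborSet v).ncard ≤ p) {c : ℕ}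
    (hv : colourRun H ident ρ j v = some c) : c ≤ p := by
  induction j with
  | zero => simp [colourRun] at hv
  | succ j ih =>
    rcases lt_or_ge j M with h | h
    · rw [colourRun_succ_of_lt h] at hv
      obtain hv | ⟨-, rfl, -⟩ := trialStep_eq_some hv
      exacts [ih hv, Nat.lt_succ_iff.1 (ρ v ⟨j, h⟩).isLt]
    · rw [colourRun_succ_of_le h] at hv
      obtain hv | ⟨-, rfl, -⟩ := greedyStep_eq_some hv
      exacts [ih hv, greedyColour_le.trans (hp v)]

lemma colourRun_add_card_ne_none [Fintype V] (hident : ident.Injective) (v : V) :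
    colourRun H ident ρ (M + Fintype.card V) v ≠ none := by
  have uncoloured : ∀ i, {v | colourRun H ident ρ (M + i) v = none}.ncard ≤ Fintype.card V - i := by
    intro i
    induction i with
    | zero => exact (Set.ncard_le_card (α := V) _).trans_eq Nat.card_eq_fintype_card
    | succ i ih =>
      rw [← add_assoc, colourRun_succ_of_le (Nat.le_add_right M i)]
      exact (ncard_greedyStep_eq_none_le hident).trans (by lia)
  have none_left := uncoloured (Fintype.card V)
  rw [Nat.sub_self, Nat.le_zero, Set.ncard_eq_zero] at none_left
  exact fun h => (none_left ▸ h : v ∈ (∅ : Set V))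

lemma colourRun_congr {ρ' : V → Fin M → Fin (p + 1)}
    (h : ∀ u, ∀ r : Fin M, (r : ℕ) < j → ρ u r = ρ' u r) :
    colourRun H ident ρ j = colourRun H ident ρ' j := by
  induction j with
  | zero => rfl
  | succ j ih =>
    have run_eq := ih fun u r hr => h u r (hr.trans j.lt_succ_self)
    rcases lt_or_ge j M with hj | hj
    · have trial_eq : (fun u => (ρ u ⟨j, hj⟩ : ℕ)) = fun u => (ρ' u ⟨j, hj⟩ : ℕ) :=
        funext fun u => congrArg _ (h u ⟨j, hj⟩ j.lt_succ_self)
      rw [colourRun_succ_of_lt hj, colourRun_succ_of_lt hj, run_eq, trial_eq]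
    · rw [colourRun_succ_of_le hj, colourRun_succ_of_le hj, run_eq]

/-- The trial colours of `v` in round `r` that are blocked by a neighbour, which has fixed or is
trying the same colour. -/
def blockedColours (H : SimpleGraph V) (ident : V → ℕ) (ρ : V → Fin M → Fin (p + 1)) (v : V)
    (r : Fin M) : Set (Fin (p + 1)) :=
  {c | ∃ u ∈ H.neighborSet v, (colourRun H ident ρ r u).getD (ρ u r) = c}

lemma mem_blockedColours_of_colourRun_eq_none (hv : colourRun H ident ρ M v = none) (r : Fin M) :
    ρ v r ∈ blockedColours H ident ρ v r := by
  have before := colourRun_eq_none_of_le r.isLt.le hv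
  have after := colourRun_eq_none_of_le (Nat.succ_le_of_lt r.isLt) hv
  by_contra h
  have accepted : ∀ u, H.Adj v u → (colourRun H ident ρ r u).getD (ρ u r) ≠ ρ v r :=
    fun u hu heq => h ⟨u, hu, heq⟩
  rw [Nat.succ_eq_add_one, colourRun_succ_of_lt r.isLt, trialStep,
    if_pos ⟨before, accepted⟩] at after
  exact Option.some_ne_none _ after

lemma ncard_blockedColours_le [Finite V] (r : Fin M) :
    (blockedColours H ident ρ v r).ncard ≤ (H.neighborSet v).ncard := by
  have image_subset : (Fin.val '' blockedColours H ident ρ v r) ⊆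
      (fun u => (colourRun H ident ρ r u).getD (ρ u r)) '' H.neighborSet v := by
    rintro _ ⟨c, ⟨u, hu, huc⟩, rfl⟩
    exact ⟨u, hu, huc⟩
  rw [← Set.ncard_image_of_injective _ Fin.val_injective]
  exact (Set.ncard_le_ncard image_subset).trans (Set.ncard_image_le (Set.toFinite _))

lemma blockedColours_update_congr [DecidableEq V] {y z : Fin M → Fin (p + 1)} {r : Fin M}
    (h : ∀ s < r, y s = z s) :
    blockedColours H ident (Function.update ρ v y) v r =
      blockedColours H ident (Function.update ρ v z) v r := by
  have run_eq : colourRun H ident (Function.update ρ v y) r =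
      colourRun H ident (Function.update ρ v z) r := by
    refine colourRun_congr fun u s hs => ?_
    rcases eq_or_ne u v with rfl | hu
    · simpa using h s hs
    · simp [hu]
  ext c
  refine exists_congr fun u => and_congr_right fun hu => ?_
  simp [run_eq, Function.update_of_ne (H.ne_of_adj hu).symm]

end ColouringProcess

section Counting

lemma ncard_forall_mem_le {β : Type*} [Finite β] {M D : ℕ} {B : Fin M → (Fin M → β) → Set β}
    (hB : ∀ r x, (B r x).ncard ≤ D) (hdep : ∀ r x y, (∀ s < r, x s = y s) → B r x = B r y) :
    {x | ∀ r, x r ∈ B r x}.ncard ≤ D ^ M := by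
  classical
  have := Fintype.ofFinite β
  induction M with
  | zero => exact Set.ncard_le_one_of_subsingleton _
  | succ M ih =>
    rcases {x | ∀ r, x r ∈ B r x}.eq_empty_or_nonempty with hempty | ⟨x₀, -⟩
    · simp [hempty]
    have tail : ∀ b, {y : Fin M → β | ∀ r, y r ∈ B r.succ (Fin.cons b y)}.ncard ≤ D ^ M := fun b =>
      ih (B := fun r y => B r.succ (Fin.cons b y)) (fun r y => hB _ _) fun r y z h =>
        hdep _ _ _ fun s hs => by
          cases s using Fin.cases with
          | zero => rfl
          | succ s => simpa using h s (Fin.succ_lt_succ_iff.1 hs)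
    have split : {x | ∀ r, x r ∈ B r x} ⊆ ⋃ b ∈ (B 0 x₀).toFinset,
        Fin.cons (α := fun _ => β) b '' {y | ∀ r, y r ∈ B r.succ (Fin.cons b y)} := by
      intro x hx
      have head_mem : x 0 ∈ B 0 x₀ :=
        hdep 0 x₀ x (fun s hs => absurd hs (Fin.not_lt_zero s)) ▸ hx 0
      refine Set.mem_biUnion (Set.mem_toFinset.2 head_mem) ⟨Fin.tail x, fun r => ?_, ?_⟩
      · rw [Fin.cons_self_tail]
        exact hx r.succ
      · exact Fin.cons_self_tail x
    calc {x | ∀ r, x r ∈ B r x}.ncard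
        ≤ ∑ b ∈ (B 0 x₀).toFinset, (Fin.cons (α := fun _ => β) b ''
            {y : Fin M → β | ∀ r, y r ∈ B r.succ (Fin.cons b y)}).ncard :=
          (Set.ncard_le_ncard split).trans (Finset.set_ncard_biUnion_le _ _)
      _ ≤ (B 0 x₀).toFinset.card • D ^ M := Finset.sum_le_card_nsmul _ _ _ fun b _ =>
          (Set.ncard_image_le (Set.toFinite _)).trans (tail b)
      _ ≤ D * D ^ M := by
          rw [smul_eq_mul, ← Set.ncard_eq_toFinset_card']
          exact Nat.mul_le_mul_right _ (hB _ _)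
      _ = D ^ (M + 1) := (pow_succ' D M).symm

lemma ncard_mul_card_le_of_update {V S : Type*} [Fintype V] [DecidableEq V] [Fintype S] (v : V)
    {E : Set (V → S)} {k : ℕ} (hE : ∀ ρ, {y | Function.update ρ v y ∈ E}.ncard ≤ k) :
    E.ncard * Fintype.card S ≤ k * Fintype.card (V → S) := by
  classical
  have resample_injOn : Set.InjOn
      (fun x : (V → S) × S => (Function.update x.1 v x.2, x.1 v)) (E ×ˢ Set.univ) := by
    rintro ⟨ρ, y⟩ - ⟨ρ', y'⟩ - h
    simp only [Prod.mk.injEq] at h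
    obtain ⟨hupd, hval⟩ := h
    have hy : y = y' := by simpa using congrFun hupd v
    have hρ : ρ = ρ' :=
      calc ρ = Function.update (Function.update ρ v y) v (ρ v) := by simp
        _ = Function.update (Function.update ρ' v y') v (ρ' v) := by rw [hupd, hval]
        _ = ρ' := by simp
    rw [hy, hρ]
  have resample_maps : ∀ x ∈ E ×ˢ (Set.univ : Set S),
      (Function.update x.1 v x.2, x.1 v) ∈
        ⋃ ρ ∈ Finset.univ, Prod.mk ρ '' {y | Function.update ρ v y ∈ E} := by
    rintro ⟨ρ, y⟩ ⟨hρ, -⟩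
    exact Set.mem_biUnion (Finset.mem_univ _) ⟨_, by simpa using hρ, rfl⟩
  calc E.ncard * Fintype.card S = (E ×ˢ (Set.univ : Set S)).ncard := by
        rw [Set.ncard_prod, Set.ncard_univ, Nat.card_eq_fintype_card]
    _ ≤ _ := Set.ncard_le_ncard_of_injOn _ resample_maps resample_injOn (Set.toFinite _)
    _ ≤ ∑ ρ : V → S, (Prod.mk ρ '' {y | Function.update ρ v y ∈ E}).ncard :=
        Finset.set_ncard_biUnion_le _ _
    _ ≤ ∑ _ρ : V → S, k := Finset.sum_le_sum fun ρ _ =>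
        (Set.ncard_image_le (Set.toFinite _)).trans (hE ρ)
    _ = k * Fintype.card (V → S) := by simp [mul_comm]

variable {V : Type*} [Fintype V] [DecidableEq V] {H : SimpleGraph V} {D : ℕ}

lemma ncard_colourRun_eq_none_mul_le (hD : ∀ v, (H.neighborSet v).ncard ≤ D) (ident : V → ℕ)
    (M p : ℕ) (v : V) :
    {ρ : V → Fin M → Fin (p + 1) | colourRun H ident ρ M v = none}.ncard * (p + 1) ^ M ≤
      D ^ M * Fintype.card (V → Fin M → Fin (p + 1)) := by
  have all_blocked : ∀ ρ : V → Fin M → Fin (p + 1),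
      {y | colourRun H ident (Function.update ρ v y) M v = none}.ncard ≤ D ^ M := fun ρ =>
    calc {y | colourRun H ident (Function.update ρ v y) M v = none}.ncard
        ≤ {y | ∀ r, y r ∈ blockedColours H ident (Function.update ρ v y) v r}.ncard :=
          Set.ncard_le_ncard fun y hy r => by
            simpa using mem_blockedColours_of_colourRun_eq_none hy r
      _ ≤ D ^ M := ncard_forall_mem_le
          (fun r y => ncard_blockedColours_le r |>.trans (hD v))
          (fun r y z h => blockedColours_update_congr h)
  simpa using ncard_mul_card_le_of_update v
    (E := {ρ | colourRun H ident ρ M v = none}) all_blocked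

lemma ncard_exists_colourRun_eq_none_mul_le (hD : ∀ v, (H.neighborSet v).ncard ≤ D)
    (ident : V → ℕ) (M p : ℕ) :
    {ρ : V → Fin M → Fin (p + 1) | ∃ v, colourRun H ident ρ M v = none}.ncard * (p + 1) ^ M ≤
      Fintype.card V * (D ^ M * Fintype.card (V → Fin M → Fin (p + 1))) := by
  rw [Set.ofPred_exists]
  calc _ ≤ (∑ v, {ρ : V → Fin M → Fin (p + 1) | colourRun H ident ρ M v = none}.ncard) *
          (p + 1) ^ M := Nat.mul_le_mul_right _ (Set.ncard_iUnion_le_of_fintype _)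
    _ = ∑ v, {ρ : V → Fin M → Fin (p + 1) | colourRun H ident ρ M v = none}.ncard *
          (p + 1) ^ M := Finset.sum_mul _ _ _
    _ ≤ ∑ _v : V, D ^ M * Fintype.card (V → Fin M → Fin (p + 1)) :=
        Finset.sum_le_sum fun v _ => ncard_colourRun_eq_none_mul_le hD ident M p v
    _ = _ := by rw [Finset.sum_const, Finset.card_univ, smul_eq_mul]

end Counting

namespace LocalAlgorithm

variable {V : Type} {A : LocalAlgorithm} {G : SimpleGraph V} {ident : V → ℕ} {ρ : V → A.Seed}

lemma config_succ_of_output_eq_none {r : ℕ} {v : V}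
    (h : A.output (A.config G ident ρ r v) = none) :
    A.config G ident ρ (r + 1) v =
      A.recv (A.config G ident ρ r v) (A.inbox G ident (A.config G ident ρ r) v) := by
  rw [config, Function.iterate_succ_apply']
  change A.step G ident (A.config G ident ρ r) v = _
  simp only [step, h]

lemma config_succ_of_output_ne_none {r : ℕ} {v : V}
    (h : A.output (A.config G ident ρ r v) ≠ none) :
    A.config G ident ρ (r + 1) v = A.config G ident ρ r v := by
  obtain ⟨c, hc⟩ := Option.ne_none_iff_exists'.1 h
  rw [config, Function.iterate_succ_apply']
  change A.step G ident (A.config G ident ρ r) v = _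
  simp only [step, hc]

lemma rounds_le {r : ℕ} (h : ∀ v, A.output (A.config G ident ρ r v) ≠ none) :
    A.rounds G ident ρ ≤ r :=
  iInf₂_le r h

end LocalAlgorithm

/-- A protocol in which every vertex shows its whole state to its neighbours in every round, and
whose vertices never halt but keep their state as soon as they have an answer. Correctness is
proved at this level, and `BroadcastProtocol.toLocal` converts a protocol to an algorithm whose
vertices halt. -/
structure BroadcastProtocol where
  Seed : Type
  State : Type
  [seedFintype : Fintype Seed]
  [seedNonempty : Nonempty Seed]
  init : (ident : ℕ) → Seed → State
  next : (round : ℕ) → State → (neighbours : Set (ℕ × State)) → State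
  answer : State → Option ℕ
  next_of_answer : ∀ round s neighbours, answer s ≠ none → next round s neighbours = s

namespace BroadcastProtocol

attribute [instance] seedFintype seedNonempty

variable (P : BroadcastProtocol) {V : Type} (G : SimpleGraph V) (ident : V → ℕ)

/-- The states of the neighbours of `v`, labelled by their identifiers. -/
def view (σ : V → P.State) (v : V) : Set (ℕ × P.State) :=
  (fun u => (ident u, σ u)) '' G.neighborSet v

/-- The states of all vertices after a number of rounds, when vertex `v` has the seed `ρ v`. -/
def run (ρ : V → P.Seed) : ℕ → V → P.State
  | 0, v => P.init (ident v) (ρ v)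
  | τ + 1, v => P.next τ (run ρ τ v) (P.view G ident (run ρ τ) v)

/-- The state of a vertex that simulates a broadcast protocol in the LOCAL model. It remembers the
last state `heard` from each neighbour, because halted neighbours are silent. It sets `out` one
round after the protocol's answer, so that its neighbours still hear its final state. -/
structure Memory where
  clock : ℕ
  current : P.State
  heard : Set (ℕ × P.State)
  out : Option ℕ

variable {P} in
/-- The remembered states `old`, overwritten by the messages `new`. -/
def refresh (old new : Set (ℕ × P.State)) : Set (ℕ × P.State) :=
  new ∪ {m ∈ old | m.1 ∉ Prod.fst '' new}

/-- The LOCAL algorithm that simulates `P`. -/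
abbrev toLocal : LocalAlgorithm where
  Seed := P.Seed
  State := P.Memory
  Msg := P.State
  init i _ seed := ⟨0, P.init i seed, ∅, none⟩
  send s _ := s.current
  recv s messages :=
    ⟨s.clock + 1, P.next s.clock s.current (refresh s.heard messages), refresh s.heard messages,
      P.answer s.current⟩
  output := Memory.out

variable (ρ : V → P.Seed)

/-- The states of the neighbours of `v` one round earlier. -/
def lastView : ℕ → V → Set (ℕ × P.State)
  | 0, _ => ∅
  | τ + 1, v => P.view G ident (P.run G ident ρ τ) v

/-- The answer of `v` one round earlier. -/
def lastAnswer : ℕ → V → Option ℕ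
  | 0, _ => none
  | τ + 1, v => P.answer (P.run G ident ρ τ v)

variable {P G ident ρ}

lemma run_succ_of_answer_ne_none {τ : ℕ} {v : V} (h : P.answer (P.run G ident ρ τ v) ≠ none) :
    P.run G ident ρ (τ + 1) v = P.run G ident ρ τ v :=
  P.next_of_answer _ _ _ h

lemma lastAnswer_succ_of_ne_none {τ : ℕ} {v : V} (h : P.lastAnswer G ident ρ τ v ≠ none) :
    P.lastAnswer G ident ρ (τ + 1) v = P.lastAnswer G ident ρ τ v := by
  cases τ with
  | zero => exact absurd rfl h
  | succ τ => exact congrArg P.answer (run_succ_of_answer_ne_none h)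

lemma refresh_image {N : Set V} {active : V → Prop} {σ σ' : V → P.State}
    (hident : ident.Injective) (h : ∀ u, ¬ active u → σ' u = σ u) :
    refresh ((fun u => (ident u, σ u)) '' N) ((fun u => (ident u, σ' u)) '' {u ∈ N | active u}) =
      (fun u => (ident u, σ' u)) '' N := by
  ext m
  constructor
  · rintro (⟨u, ⟨hu, -⟩, rfl⟩ | ⟨⟨u, hu, rfl⟩, hsilent⟩)
    · exact ⟨u, hu, rfl⟩
    · have inactive : ¬ active u := fun hact => hsilent ⟨_, ⟨u, ⟨hu, hact⟩, rfl⟩, rfl⟩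
      exact ⟨u, hu, by simp only [h u inactive]⟩
  · rintro ⟨u, hu, rfl⟩
    by_cases hact : active u
    · exact .inl ⟨u, ⟨hu, hact⟩, rfl⟩
    · refine .inr ⟨⟨u, hu, by simp only [h u hact]⟩, ?_⟩
      rintro ⟨_, ⟨w, ⟨-, hw⟩, rfl⟩, hwu⟩
      exact hact (hident hwu ▸ hw)

lemma refresh_lastView (hident : ident.Injective) (τ : ℕ) (v : V) :
    refresh (P.lastView G ident ρ τ v)
        ((fun u => (ident u, P.run G ident ρ τ u)) ''
          {u ∈ G.neighborSet v | P.lastAnswer G ident ρ τ u = none}) =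
      P.view G ident (P.run G ident ρ τ) v := by
  cases τ with
  | zero => simp [refresh, lastView, lastAnswer, view, SimpleGraph.neighborSet]
  | succ τ => exact refresh_image hident fun u hu => run_succ_of_answer_ne_none hu

lemma toLocal_config (hident : ident.Injective) (τ : ℕ) (v : V) :
    P.toLocal.output (P.toLocal.config G ident ρ τ v) = P.lastAnswer G ident ρ τ v ∧
      (P.lastAnswer G ident ρ τ v = none → P.toLocal.config G ident ρ τ v =
        ⟨τ, P.run G ident ρ τ v, P.lastView G ident ρ τ v, none⟩) := by
  induction τ generalizing v with
  | zero => exact ⟨rfl, fun _ => rfl⟩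
  | succ τ ih =>
    by_cases hv : P.lastAnswer G ident ρ τ v = none
    · have inbox_eq : P.toLocal.inbox G ident (P.toLocal.config G ident ρ τ) v =
          (fun u => (ident u, P.run G ident ρ τ u)) ''
            {u ∈ G.neighborSet v | P.lastAnswer G ident ρ τ u = none} := by
        ext m
        constructor
        · rintro ⟨u, hu, hactive, rfl⟩
          have hactive := (ih u).1.symm.trans hactive
          exact ⟨u, ⟨hu, hactive⟩, by rw [(ih u).2 hactive]⟩
        · rintro ⟨u, ⟨hu, hactive⟩, rfl⟩
          exact ⟨u, hu, (ih u).1.trans hactive, by rw [(ih u).2 hactive]⟩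
      have config_succ : P.toLocal.config G ident ρ (τ + 1) v =
          ⟨τ + 1, P.run G ident ρ (τ + 1) v, P.lastView G ident ρ (τ + 1) v,
            P.answer (P.run G ident ρ τ v)⟩ := by
        rw [LocalAlgorithm.config_succ_of_output_eq_none ((ih v).1.trans hv), inbox_eq,
          (ih v).2 hv]
        simp only [toLocal, refresh_lastView hident]
        rfl
      exact ⟨congrArg Memory.out config_succ, fun h => config_succ.trans (by rw [← h]; rfl)⟩
    · rw [lastAnswer_succ_of_ne_none hv,
        LocalAlgorithm.config_succ_of_output_ne_none fun h => hv ((ih v).1.symm.trans h)]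
      exact ⟨(ih v).1, fun h => absurd h hv⟩

lemma toLocal_output_config_succ (hident : ident.Injective) (ρ : V → P.Seed) (τ : ℕ) (v : V) :
    P.toLocal.output (P.toLocal.config G ident ρ (τ + 1) v) = P.answer (P.run G ident ρ τ v) :=
  (toLocal_config hident (τ + 1) v).1

end BroadcastProtocol

/-- The state of a vertex in `peelProtocol`: its identifier, its trial colours, its level in the
H-partition, and the colour that it has fixed within its level. -/
structure PeelState (M p : ℕ) where
  ident : ℕ
  seed : Fin M → Fin (p + 1)
  level : ℕ
  colour : Option ℕ

open Classical in
/-- The colour that an uncoloured vertex in state `s` fixes in round `j` of the colouring phase,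
when its neighbours of the same level have the states `peers`. -/
noncomputable def PeelState.choose {M p : ℕ} (s : PeelState M p) (j : ℕ)
    (peers : Set (ℕ × PeelState M p)) : Option ℕ :=
  if h : j < M then
    if ∀ m ∈ peers, m.2.colour.getD (m.2.seed ⟨j, h⟩) ≠ s.seed ⟨j, h⟩ then some (s.seed ⟨j, h⟩)
    else none
  else
    if ∀ m ∈ peers, m.2.colour = none → s.ident < m.1 then
      some (sInf {c | ∀ m ∈ peers, m.2.colour ≠ some c})
    else none

open Classical in
/-- The protocol that computes the H-partition with degree threshold `D` in `L` rounds of peeling,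
and then colours all levels at the same time, each with its own `p + 1` colours, by `M` random
trials and the greedy clean-up. -/
noncomputable abbrev peelProtocol (L M D p : ℕ) : BroadcastProtocol where
  Seed := Fin M → Fin (p + 1)
  State := PeelState M p
  init i seed := ⟨i, seed, 0, none⟩
  next τ s neighbours :=
    if s.colour ≠ none then s
    else if τ < L then
      if s.level = τ ∧ D < {m ∈ neighbours | m.2.level = τ}.ncard then { s with level := τ + 1 }
      else s
    else { s with colour := s.choose (τ - L) {m ∈ neighbours | m.2.level = s.level} }
  answer s := s.colour.map (s.level * (p + 1) + ·)
  next_of_answer τ s neighbours h := if_pos fun hnone => h (by rw [hnone, Option.map_none])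

section PeelProtocol

variable {V : Type} {G : SimpleGraph V} {ident : V → ℕ} {L M D p : ℕ}
  {ρ : V → Fin M → Fin (p + 1)}

lemma peelProtocol_run_of_le (hident : ident.Injective) {τ : ℕ} (hτ : τ ≤ L) (v : V) :
    (peelProtocol L M D p).run G ident ρ τ v = ⟨ident v, ρ v, peelLevel G D τ v, none⟩ := by
  induction τ generalizing v with
  | zero => rfl
  | succ τ ih =>
    have ih := ih (by lia)
    have survivors : {m ∈ (peelProtocol L M D p).view G ident
        ((peelProtocol L M D p).run G ident ρ τ) v | m.2.level = τ}.ncard =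
          (G.neighborSet v ∩ {u | peelLevel G D τ u = τ}).ncard := by
      rw [← Set.ncard_image_of_injective (f := fun u =>
        (ident u, (peelProtocol L M D p).run G ident ρ τ u)) _
        fun u w h => hident (congrArg Prod.fst h)]
      congr 1
      ext m
      constructor
      · rintro ⟨⟨u, hu, rfl⟩, hlevel⟩
        exact ⟨u, ⟨hu, by simpa [ih] using hlevel⟩, rfl⟩
      · rintro ⟨u, ⟨hu, hlevel⟩, rfl⟩
        exact ⟨⟨u, hu, rfl⟩, by simpa [ih] using hlevel⟩
    rw [BroadcastProtocol.run]
    simp only [survivors, ih, peelLevel, ne_eq, not_true_eq_false, if_false,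
      if_pos (Nat.lt_of_succ_le hτ)]
    split_ifs <;> rfl

lemma choose_eq_colourRun_succ {σ : V → PeelState M p} {ℓ : V → ℕ} {j : ℕ}
    (hσ : ∀ u, σ u = ⟨ident u, ρ u, ℓ u, colourRun (levelGraph G ℓ) ident ρ j u⟩) {v : V}
    (hv : colourRun (levelGraph G ℓ) ident ρ j v = none) :
    (σ v).choose j {m ∈ (fun u => (ident u, σ u)) '' G.neighborSet v | m.2.level = (σ v).level} =
      colourRun (levelGraph G ℓ) ident ρ (j + 1) v := by
  classical
  have peers : {m ∈ (fun u => (ident u, σ u)) '' G.neighborSet v | m.2.level = (σ v).level} =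
      (fun u => (ident u, σ u)) '' (levelGraph G ℓ).neighborSet v := by
    ext m
    constructor
    · rintro ⟨⟨u, hu, rfl⟩, hlevel⟩
      exact ⟨u, ⟨hu, by simpa [hσ, eq_comm] using hlevel⟩, rfl⟩
    · rintro ⟨u, ⟨hu, hlevel⟩, rfl⟩
      exact ⟨⟨u, hu, rfl⟩, by simpa [hσ, eq_comm] using hlevel⟩
  rw [peers, PeelState.choose]
  rcases lt_or_ge j M with h | h
  · rw [dif_pos h, colourRun_succ_of_lt h, trialStep, hv, hσ v]
    exact if_congr (by simp [hσ]) rfl rfl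
  · rw [dif_neg h.not_gt, colourRun_succ_of_le h, greedyStep, hv, hσ v, greedyColour]
    exact if_congr (by simp [hσ]) (by simp [hσ]) rfl

lemma peelProtocol_run_add (hident : ident.Injective) (j : ℕ) (v : V) :
    (peelProtocol L M D p).run G ident ρ (L + j) v =
      ⟨ident v, ρ v, peelLevel G D L v,
        colourRun (levelGraph G (peelLevel G D L)) ident ρ j v⟩ := by
  induction j generalizing v with
  | zero => exact peelProtocol_run_of_le hident le_rfl v
  | succ j ih =>
    by_cases hv : colourRun (levelGraph G (peelLevel G D L)) ident ρ j v = none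
    · rw [← choose_eq_colourRun_succ ih hv, ← add_assoc, BroadcastProtocol.run]
      simp [ih, hv, BroadcastProtocol.view]
    · rw [← add_assoc, BroadcastProtocol.run_succ_of_answer_ne_none (by simpa [ih] using hv), ih,
        colourRun_succ_of_ne_none hv]

lemma peelProtocol_answer_run_add (hident : ident.Injective) (ρ : V → Fin M → Fin (p + 1)) (j : ℕ)
    (v : V) :
    (peelProtocol L M D p).answer ((peelProtocol L M D p).run G ident ρ (L + j) v) =
      (colourRun (levelGraph G (peelLevel G D L)) ident ρ j v).map
        (peelLevel G D L v * (p + 1) + ·) := by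
  rw [peelProtocol_run_add hident]

end PeelProtocol

namespace LocalAlgorithm

variable {V : Type} {A : LocalAlgorithm} {G : SimpleGraph V} {ident : V → ℕ}

lemma ProducesColoring.mono {ρ : V → A.Seed} {p p' : ℕ} (h : A.ProducesColoring G ident ρ p)
    (hp : p ≤ p') : A.ProducesColoring G ident ρ p' := by
  obtain ⟨r, f, hf⟩ := h
  exact ⟨r, SimpleGraph.Coloring.mk (fun v => Fin.castLE hp (f v)) fun huv hne =>
    f.valid huv (Fin.castLE_injective hp hne), hf⟩

lemma one_sub_le_prob [Finite V] {bad E : Set (V → A.Seed)} {ε : ℝ}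
    (h : ∀ ρ ∉ bad, ρ ∈ E) (hbad : bad.ncard ≤ ε * Nat.card (V → A.Seed)) :
    1 - ε ≤ A.prob E := by
  have card_pos : (0 : ℝ) < Nat.card (V → A.Seed) := by exact_mod_cast Nat.card_pos
  have compl_le : (Eᶜ.ncard : ℝ) ≤ bad.ncard := by
    exact_mod_cast Set.ncard_le_ncard (Set.compl_subset_comm.1 h)
  have card_eq : (E.ncard + Eᶜ.ncard : ℝ) = Nat.card (V → A.Seed) := by
    exact_mod_cast Set.ncard_add_ncard_compl E
  rw [prob, le_div_iff₀ card_pos]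
  linarith

variable [Fintype V]

lemma Colors.mono [DecidableEq V] {p p' : ℕ} {T T' δ δ' : ℝ} (h : A.Colors G ident p T δ)
    (hp : p ≤ p') (hT : T ≤ T') (hδ : δ ≤ δ') : A.Colors G ident p' T' δ' := by
  have hT := ENNReal.ofReal_le_ofReal hT
  refine ⟨fun ρ => (h.1 ρ).mono hp, h.2.1.trans hT, ?_⟩
  calc 1 - δ' ≤ 1 - δ := sub_le_sub_left hδ 1
    _ ≤ A.prob {ρ | A.rounds G ident ρ ≤ ENNReal.ofReal T} := h.2.2
    _ ≤ A.prob {ρ | A.rounds G ident ρ ≤ ENNReal.ofReal T'} := by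
      unfold prob
      gcongr ?_ / _
      exact_mod_cast Set.ncard_le_ncard fun ρ (hρ : _ ≤ _) => hρ.trans hT

lemma sum_rounds_le [DecidableEq V] {bad : Set (V → A.Seed)} {T₁ T₂ : ℕ}
    (h₁ : ∀ ρ ∉ bad, A.rounds G ident ρ ≤ T₁) (h₂ : ∀ ρ, A.rounds G ident ρ ≤ (T₁ + T₂ : ℕ)) :
    ∑ ρ : V → A.Seed, A.rounds G ident ρ ≤
      (Fintype.card (V → A.Seed) * T₁ + bad.ncard * T₂ : ℕ) := by
  classical
  calc ∑ ρ : V → A.Seed, A.rounds G ident ρ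
      ≤ ∑ ρ : V → A.Seed, ((T₁ + if ρ ∈ bad then T₂ else 0 : ℕ) : ℝ≥0∞) := by
        refine Finset.sum_le_sum fun ρ _ => ?_
        split_ifs with h
        exacts [h₂ ρ, h₁ ρ h]
    _ = (Fintype.card (V → A.Seed) * T₁ + bad.ncard * T₂ : ℕ) := by
        rw [← Nat.cast_sum, Finset.sum_add_distrib, Finset.sum_const, ← Finset.sum_filter,
          Finset.sum_const, Finset.card_univ, smul_eq_mul, smul_eq_mul,
          Set.ncard_eq_toFinset_card', Set.toFinset]
        simp

lemma expectedRounds_le [DecidableEq V] {bad : Set (V → A.Seed)} {T₁ T₂ : ℕ} {ε : ℝ}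
    (h₁ : ∀ ρ ∉ bad, A.rounds G ident ρ ≤ T₁) (h₂ : ∀ ρ, A.rounds G ident ρ ≤ (T₁ + T₂ : ℕ))
    (hbad : bad.ncard ≤ ε * Fintype.card (V → A.Seed)) :
    A.expectedRounds G ident ≤ ENNReal.ofReal (T₁ + T₂ * ε) := by
  refine ENNReal.div_le_of_le_mul ((sum_rounds_le h₁ h₂).trans ?_)
  rw [← ENNReal.ofReal_natCast, ← ENNReal.ofReal_natCast (Fintype.card (V → A.Seed)),
    ← ENNReal.ofReal_mul' (Nat.cast_nonneg _)]
  refine ENNReal.ofReal_le_ofReal ?_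
  push_cast
  calc (Fintype.card (V → A.Seed) * T₁ + bad.ncard * T₂ : ℝ)
      ≤ Fintype.card (V → A.Seed) * T₁ + ε * Fintype.card (V → A.Seed) * T₂ := by gcongr
    _ = (T₁ + T₂ * ε) * Fintype.card (V → A.Seed) := by ring

end LocalAlgorithm

section PeelAlgorithm

variable {V : Type} {G : SimpleGraph V} {ident : V → ℕ} {L M D p : ℕ}

lemma exists_coloring_of_levelGraph {ℓ col : V → ℕ} (hℓ : ∀ v, ℓ v < L) (hcol : ∀ v, col v ≤ p)
    (hproper : ∀ ⦃u v⦄, (levelGraph G ℓ).Adj u v → col u ≠ col v) :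
    ∃ f : G.Coloring (Fin (L * (p + 1))), ∀ v, (f v : ℕ) = ℓ v * (p + 1) + col v := by
  have lt_mul : ∀ v, ℓ v * (p + 1) + col v < L * (p + 1) := fun v => by
    calc ℓ v * (p + 1) + col v < (ℓ v + 1) * (p + 1) := by linarith [hcol v]
      _ ≤ L * (p + 1) := Nat.mul_le_mul_right _ (hℓ v)
  refine ⟨SimpleGraph.Coloring.mk (fun v => ⟨ℓ v * (p + 1) + col v, lt_mul v⟩) ?_, fun v => rfl⟩
  intro u v huv h
  rw [Fin.mk.injEq] at h
  have col_eq : col u = col v := by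
    have := congrArg (· % (p + 1)) h
    simpa only [Nat.mul_add_mod', Nat.mod_eq_of_lt (Nat.lt_succ_of_le (hcol _))] using this
  have level_eq : ℓ u = ℓ v :=
    Nat.eq_of_mul_eq_mul_right p.succ_pos (Nat.add_right_cancel (col_eq ▸ h))
  exact hproper ⟨huv, level_eq⟩ col_eq

lemma toLocal_output_peelProtocol (hident : ident.Injective) (ρ : V → Fin M → Fin (p + 1)) (j : ℕ)
    (v : V) :
    (peelProtocol L M D p).toLocal.output
        ((peelProtocol L M D p).toLocal.config G ident ρ (L + j + 1) v) =
      (colourRun (levelGraph G (peelLevel G D L)) ident ρ j v).map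
        (peelLevel G D L v * (p + 1) + ·) := by
  rw [BroadcastProtocol.toLocal_output_config_succ hident, peelProtocol_answer_run_add hident]

lemma rounds_peelProtocol_le (hident : ident.Injective) {ρ : V → Fin M → Fin (p + 1)} {j : ℕ}
    (h : ∀ v, colourRun (levelGraph G (peelLevel G D L)) ident ρ j v ≠ none) :
    (peelProtocol L M D p).toLocal.rounds G ident ρ ≤ (L + j + 1 : ℕ) :=
  LocalAlgorithm.rounds_le fun v => by
    rw [toLocal_output_peelProtocol hident]
    simpa only [ne_eq, Option.map_eq_none_iff] using h v

lemma producesColoring_peelProtocol [Finite V] (hident : ident.Injective)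
    (hL : ∀ v, peelLevel G D L v < L) (hD : D ≤ p) (ρ : V → Fin M → Fin (p + 1)) :
    (peelProtocol L M D p).toLocal.ProducesColoring G ident ρ (L * (p + 1)) := by
  have := Fintype.ofFinite V
  have exists_colour := fun v => Option.ne_none_iff_exists'.1 <|
    colourRun_add_card_ne_none (H := levelGraph G (peelLevel G D L)) (ρ := ρ) hident v
  choose col hcol using exists_colour
  have proper : ∀ ⦃u v⦄, (levelGraph G (peelLevel G D L)).Adj u v → col u ≠ col v :=
    fun u v huv h => isPartialColouring_colourRun _ huv _ (hcol u) (h ▸ hcol v)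
  have col_le : ∀ v, col v ≤ p := fun v =>
    colourRun_le (fun v => (ncard_neighborSet_levelGraph_peelLevel_le (hL v)).trans hD) (hcol v)
  obtain ⟨f, hf⟩ := exists_coloring_of_levelGraph hL col_le proper
  refine ⟨L + (M + Fintype.card V) + 1, f, fun v => ?_⟩
  rw [toLocal_output_peelProtocol hident, hcol, hf, Option.map_some]

variable [Fintype V]

lemma ncard_exists_colourRun_eq_none_le [DecidableEq V] {H : SimpleGraph V}
    (hD : ∀ v, (H.neighborSet v).ncard ≤ D) (ident : V → ℕ) (M p : ℕ) :
    ({ρ : V → Fin M → Fin (p + 1) | ∃ v, colourRun H ident ρ M v = none}.ncard : ℝ) ≤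
      Fintype.card V * (D / (p + 1) : ℝ) ^ M * Fintype.card (V → Fin M → Fin (p + 1)) := by
  have count : ({ρ : V → Fin M → Fin (p + 1) |
      ∃ v, colourRun H ident ρ M v = none}.ncard : ℝ) * (p + 1) ^ M ≤
        Fintype.card V * (D ^ M * Fintype.card (V → Fin M → Fin (p + 1))) := by
    exact_mod_cast ncard_exists_colourRun_eq_none_mul_le hD ident M p
  rw [← le_div_iff₀ (by positivity)] at count
  refine count.trans_eq ?_
  rw [div_pow]
  ring

theorem colors_peelProtocol [DecidableEq V] (hident : ident.Injective)
    (hL : ∀ v, peelLevel G D L v < L) (hD : D ≤ p) {ε : ℝ}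
    (hε : Fintype.card V * (D / (p + 1) : ℝ) ^ M ≤ ε) :
    (peelProtocol L M D p).toLocal.Colors G ident (L * (p + 1))
      (L + M + 1 + Fintype.card V * ε) ε := by
  set H := levelGraph G (peelLevel G D L)
  set bad := {ρ : V → Fin M → Fin (p + 1) | ∃ v, colourRun H ident ρ M v = none}
  have card_bad : (bad.ncard : ℝ) ≤ ε * Fintype.card (V → Fin M → Fin (p + 1)) :=
    (ncard_exists_colourRun_eq_none_le
      (fun v => ncard_neighborSet_levelGraph_peelLevel_le (hL v)) ident M p).trans (by gcongr)
  have rounds_of_not_bad : ∀ ρ ∉ bad,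
      (peelProtocol L M D p).toLocal.rounds G ident ρ ≤ (L + M + 1 : ℕ) := fun ρ hρ =>
    rounds_peelProtocol_le hident (not_exists.1 hρ)
  have rounds_le : ∀ ρ, (peelProtocol L M D p).toLocal.rounds G ident ρ ≤
      (L + M + 1 + Fintype.card V : ℕ) := fun ρ =>
    (rounds_peelProtocol_le hident (colourRun_add_card_ne_none hident)).trans_eq
      (by congr 1; ring)
  have hε : 0 ≤ ε := le_trans (by positivity) hε
  refine ⟨producesColoring_peelProtocol hident hL hD, ?_, ?_⟩
  · exact_mod_cast LocalAlgorithm.expectedRounds_le rounds_of_not_bad rounds_le card_bad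
  · refine LocalAlgorithm.one_sub_le_prob (fun ρ hρ => (rounds_of_not_bad ρ hρ).trans ?_)
      (by rwa [Nat.card_eq_fintype_card])
    rw [← ENNReal.ofReal_natCast]
    refine ENNReal.ofReal_le_ofReal ?_
    push_cast
    exact le_add_of_nonneg_right (by positivity)

end PeelAlgorithm

section Parameters

lemma rpow_half_natCast_eq_sqrt_pow {t : ℝ} (ht : 0 ≤ t) (k : ℕ) : t ^ ((k : ℝ) / 2) = √t ^ k := by
  rw [Real.sqrt_eq_rpow, ← Real.rpow_natCast, ← Real.rpow_mul ht]
  ring_nf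

lemma lt_sqrt_pow {t x : ℝ} (ht : 1 < t) (hx : 0 < x) {k : ℕ} (h : 2 * Real.logb t x < k) :
    x < √t ^ k := by
  rw [← rpow_half_natCast_eq_sqrt_pow (by linarith), ← Real.logb_lt_iff_lt_rpow ht hx]
  linarith

lemma le_sqrt_pow {t x : ℝ} (ht : 1 < t) (hx : 0 < x) {k : ℕ} (h : 2 * Real.logb t x ≤ k) :
    x ≤ √t ^ k := by
  rw [← rpow_half_natCast_eq_sqrt_pow (by linarith), ← Real.logb_le_iff_le_rpow ht hx]
  linarith

lemma one_le_logb_two {x : ℝ} (hx : 2 ≤ x) : 1 ≤ Real.logb 2 x := by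
  rw [Real.le_logb_iff_rpow_le one_lt_two (by linarith), Real.rpow_one]
  exact hx

lemma logb_le_logb_two {t x : ℝ} (ht : 2 ≤ t) (hx : 1 ≤ x) : Real.logb t x ≤ Real.logb 2 x :=
  div_le_div_of_nonneg_left (Real.log_nonneg hx) (Real.log_pos one_lt_two)
    (Real.log_le_log two_pos ht)

lemma levels_mul_palette_le {t x b : ℝ} (ht : 2 ≤ t) (hx : 2 ≤ x) (hb : 1 ≤ b) :
    ((⌊2 * Real.logb t x⌋₊ + 1) * (⌊2 * b * t⌋₊ + 1) : ℝ) ≤ 9 * (b * t * Real.logb 2 x) := by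
  have levels : (⌊2 * Real.logb t x⌋₊ + 1 : ℝ) ≤ 3 * Real.logb 2 x := by
    have := Nat.floor_le (mul_nonneg two_pos.le (Real.logb_nonneg (by linarith : 1 < t)
      (by linarith : 1 ≤ x)))
    linarith [logb_le_logb_two ht (by linarith : 1 ≤ x), one_le_logb_two hx]
  have palette : (⌊2 * b * t⌋₊ + 1 : ℝ) ≤ 3 * (b * t) := by
    have := Nat.floor_le (show 0 ≤ 2 * b * t by positivity)
    nlinarith
  calc ((⌊2 * Real.logb t x⌋₊ + 1) * (⌊2 * b * t⌋₊ + 1) : ℝ)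
      ≤ (3 * Real.logb 2 x) * (3 * (b * t)) :=
        mul_le_mul levels palette (by positivity) (by linarith [one_le_logb_two hx])
    _ = 9 * (b * t * Real.logb 2 x) := by ring

lemma floor_div_floor_add_one_le {b t : ℝ} (hb : 0 ≤ b) (ht : 0 < t) :
    (⌊b * √t⌋₊ / (⌊b * t⌋₊ + 1) : ℝ) ≤ 1 / √t := by
  rw [div_le_div_iff₀ (by positivity) (Real.sqrt_pos.2 ht)]
  calc (⌊b * √t⌋₊ * √t : ℝ) ≤ b * √t * √t := by gcongr; exact Nat.floor_le (by positivity)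
    _ = b * t := by rw [mul_assoc, Real.mul_self_sqrt ht.le]
    _ ≤ 1 * (⌊b * t⌋₊ + 1) := by rw [one_mul]; exact (Nat.lt_floor_add_one _).le

lemma mul_trial_failure_pow_le {b t : ℝ} (hb : 0 ≤ b) (ht : 1 < t) {x : ℝ} (hx : 0 < x) (d : ℕ)
    {M : ℕ} (hM : 2 * (d + 2) * Real.logb t x ≤ M) :
    x * (⌊b * √t⌋₊ / (⌊b * t⌋₊ + 1) : ℝ) ^ M ≤ 1 / x ^ (d + 1) := by
  have pow_le : x ^ (d + 2) ≤ √t ^ M := by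
    refine le_sqrt_pow ht (by positivity) ?_
    rw [Real.logb_pow]
    push_cast
    linarith
  calc x * (⌊b * √t⌋₊ / (⌊b * t⌋₊ + 1) : ℝ) ^ M
      ≤ x * (1 / √t) ^ M := by
        gcongr x * ?_ ^ M
        exact floor_div_floor_add_one_le hb (zero_lt_one.trans ht)
    _ ≤ x * (1 / x ^ (d + 2)) := by rw [one_div_pow]; gcongr
    _ = 1 / x ^ (d + 1) := by rw [pow_succ' x (d + 1)]; field_simp

lemma rounds_bound_le {ℓ x : ℝ} (hℓ : 0 ≤ ℓ) (hx : 1 ≤ x) (d : ℕ) :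
    (⌊2 * ℓ⌋₊ + 1 + ⌈2 * (d + 2) * ℓ⌉₊ + 1 + x * (1 / x ^ (d + 1)) : ℝ) ≤ (2 * d + 6) * ℓ + 4 := by
  have levels := Nat.floor_le (mul_nonneg two_pos.le hℓ)
  have trials := Nat.ceil_lt_add_one (show 0 ≤ 2 * (d + 2) * ℓ by positivity)
  have cleanup : x * (1 / x ^ (d + 1)) ≤ 1 := by
    rw [mul_one_div, div_le_one (by positivity)]
    exact le_self_pow₀ hx d.succ_ne_zero
  linarith

/-- The LOCAL algorithm for the parameters `n`, `a`, `t`, where `a` estimates the arboricity up to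
the factor `c` and the failure probability is at most `1 / n ^ d`. The degree threshold
`2 * c * a * √t` makes each peeling round shrink the graph by the factor `√t`, and with
`2 * c * a * t` colours each trial fails with probability at most `1 / √t`. -/
noncomputable def tradeoffAlgorithm (c : ℝ) (d n : ℕ) (a t : ℝ) : LocalAlgorithm :=
  (peelProtocol (⌊2 * Real.logb t n⌋₊ + 1) ⌈2 * (d + 2) * Real.logb t n⌉₊ ⌊2 * (c * a) * √t⌋₊
    ⌊2 * (c * a) * t⌋₊).toLocal

variable {V : Type} [Fintype V] {G : SimpleGraph V} {ident : V → ℕ}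

lemma two_le_card_of_ne_bot (hG : G ≠ ⊥) : 2 ≤ Fintype.card V := by
  obtain ⟨u, v, huv⟩ := SimpleGraph.ne_bot_iff_exists_adj.1 hG
  exact Fintype.one_lt_card_iff.2 ⟨u, v, huv.ne⟩

theorem colors_tradeoffAlgorithm [DecidableEq V] {c : ℝ} (hc : 1 ≤ c) (d : ℕ) (hG : G ≠ ⊥)
    (hident : ident.Injective) {a : ℝ} (ha : a ≤ c * G.arboricity)
    (ha' : G.arboricity ≤ c * a) {t : ℝ} (ht : 2 < t) :
    (tradeoffAlgorithm c d (Fintype.card V) a t).Colors G ident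
      ⌊9 * c ^ 2 * (t * G.arboricity * Real.logb 2 (Fintype.card V))⌋₊
      ((2 * d + 6) * Real.logb t (Fintype.card V) + 4) (1 / Fintype.card V ^ d) := by
  have card_ge : (2 : ℝ) ≤ Fintype.card V := by exact_mod_cast two_le_card_of_ne_bot hG
  have estimate_ge : 1 ≤ c * a :=
    le_trans (by exact_mod_cast arboricity_pos hG) ha'
  have estimate_le : c * a ≤ c ^ 2 * G.arboricity := by nlinarith
  have sqrt_le : √t ≤ t := Real.sqrt_le_self_iff.2 (.inr (by linarith))
  have hℓ : 0 ≤ Real.logb t (Fintype.card V) := Real.logb_nonneg (by linarith) (by linarith)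
  have levels := Nat.lt_floor_add_one (2 * Real.logb t (Fintype.card V))
  refine (colors_peelProtocol hident ?_ ?_ (mul_trial_failure_pow_le (by positivity) (by linarith)
    (by linarith) d (Nat.le_ceil _))).mono ?_ ?_ ?_
  · refine peelLevel_lt (Real.sqrt_nonneg t) ?_
      (lt_sqrt_pow (by linarith) (by linarith) (by exact_mod_cast levels))
    calc 2 * (G.arboricity : ℝ) * √t ≤ 2 * (c * a) * √t := by gcongr
      _ ≤ ⌊2 * (c * a) * √t⌋₊ + 1 := (Nat.lt_floor_add_one _).le
  · exact Nat.floor_le_floor (by gcongr)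
  · refine Nat.le_floor ?_
    push_cast
    calc _ ≤ 9 * (c * a * t * Real.logb 2 (Fintype.card V)) :=
          levels_mul_palette_le ht.le card_ge estimate_ge
      _ ≤ 9 * (c ^ 2 * G.arboricity * t * Real.logb 2 (Fintype.card V)) := by
          have := one_le_logb_two card_ge
          gcongr
      _ = 9 * c ^ 2 * (t * G.arboricity * Real.logb 2 (Fintype.card V)) := by ring
  · push_cast
    exact rounds_bound_le hℓ (by linarith) d
  · have := card_ge
    gcongr
    · linarith
    · exact d.le_succ

end Parameters

lemma exists_iterate_logb_two_le_one (x : ℝ) : ∃ i : ℕ, (Real.logb 2)^[i] x ≤ 1 := by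
  obtain ⟨m, hm⟩ := exists_nat_ge x
  induction m generalizing x with
  | zero => exact ⟨0, by rw [Function.iterate_zero_apply]; push_cast at hm; linarith⟩
  | succ m ih =>
    rcases le_or_gt x 1 with hx | hx
    · exact ⟨0, hx⟩
    · have logb_le : Real.logb 2 x ≤ m := by
        rw [Real.logb_le_iff_le_rpow one_lt_two (by linarith), Real.rpow_natCast]
        exact hm.trans (by exact_mod_cast m.lt_two_pow_self)
      obtain ⟨i, hi⟩ := ih _ logb_le
      exact ⟨i + 1, hi⟩

lemma one_le_logStar {n : ℕ} (hn : 2 ≤ n) : 1 ≤ logStar n := by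
  have logStar_mem : (Real.logb 2)^[logStar n] (n : ℝ) ≤ 1 :=
    Nat.sInf_mem (s := {i : ℕ | (Real.logb 2)^[i] (n : ℝ) ≤ 1}) (exists_iterate_logb_two_le_one n)
  by_contra! h
  rw [Nat.lt_one_iff.1 h, Function.iterate_zero_apply] at logStar_mem
  norm_cast at logStar_mem
  lia

lemma logb_rpow_one_div_self {x k : ℝ} (hx : 1 < x) : Real.logb (x ^ (1 / k)) x = k := by
  rw [Real.logb, Real.log_rpow (by linarith), one_div_mul_eq_div,
    div_div_cancel₀ (Real.log_pos hx).ne']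

theorem mainTheorem10_general (D : ℝ) {c : ℝ} (hc : 1 ≤ c) (d : ℕ) :
    ∃ (C : ℝ) (A : ℕ → ℝ → ℝ → LocalAlgorithm), 0 < C ∧
      ∀ {V : Type} [Fintype V] [DecidableEq V] {G : SimpleGraph V}, G ≠ ⊥ →
      ∀ {ident : V → ℕ}, ident.Injective →
      ∀ {a : ℝ}, a ≤ c * G.arboricity → G.arboricity ≤ c * a →
      ∀ {n : ℕ}, Fintype.card V = n →
        (∀ t : ℝ, 2 < t →
          (A n a t).Colors G ident ⌊C * (t * G.arboricity * Real.logb 2 n)⌋₊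
            (C * (Real.logb t n + 1)) (1 / n ^ d)) ∧
        (∀ k : ℝ, 0 < k → 2 < (n : ℝ) ^ (1 / k) →
          (A n a (n ^ (1 / k))).Colors G ident
            ⌊C * (G.arboricity * (n : ℝ) ^ (1 / k) * Real.logb 2 n)⌋₊
            (C * (k + 1)) (1 / n ^ d) ∧
          (1 ≤ D * k →
            (A n a (n ^ (1 / k))).Colors G ident
              ⌊C * (G.arboricity * (n : ℝ) ^ (1 / k) * Real.logb 2 n)⌋₊
              (C * k) (1 / n ^ d))) := by
  set C : ℝ := 9 * c ^ 2 + (2 * d + 6) * (1 + |D|)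
  have C_pos : 0 < C := by positivity
  refine ⟨C, tradeoffAlgorithm c d, C_pos, ?_⟩
  rintro V _ _ G hG ident hident a ha ha' n rfl
  have card_ge : (2 : ℝ) ≤ Fintype.card V := by exact_mod_cast two_le_card_of_ne_bot hG
  have colors {t T : ℝ} (ht : 2 < t) (hT : (2 * d + 6) * Real.logb t (Fintype.card V) + 4 ≤ T) :
      (tradeoffAlgorithm c d (Fintype.card V) a t).Colors G ident
        ⌊C * (t * G.arboricity * Real.logb 2 (Fintype.card V))⌋₊ T (1 / Fintype.card V ^ d) := by
    refine (colors_tradeoffAlgorithm hc d hG hident ha ha' ht).mono ?_ hT le_rfl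
    have := one_le_logb_two card_ge
    gcongr
    exact le_add_of_nonneg_right (by positivity)
  have time_le {ℓ : ℝ} (hℓ : 0 ≤ ℓ) : (2 * d + 6) * ℓ + 4 ≤ C * (ℓ + 1) := by
    have : 2 * d + 6 ≤ C := by nlinarith [sq_nonneg c, abs_nonneg D]
    nlinarith
  refine ⟨fun t ht => colors ht (time_le (Real.logb_nonneg (by linarith) (by linarith))),
    fun k hk ht => ?_⟩
  have logb_eq : Real.logb ((Fintype.card V : ℝ) ^ (1 / k)) (Fintype.card V) = k :=
    logb_rpow_one_div_self (by linarith)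
  rw [mul_comm (G.arboricity : ℝ)]
  refine ⟨colors ht (by rw [logb_eq]; exact time_le hk.le), fun hDk => colors ht ?_⟩
  have hDk : 1 ≤ |D| * k := hDk.trans (by gcongr; exact le_abs_self D)
  rw [logb_eq]
  calc (2 * d + 6) * k + 4 ≤ (2 * d + 6) * k + (2 * d + 6) * (|D| * k) := by nlinarith
    _ ≤ 9 * c ^ 2 * k + (2 * d + 6) * (1 + |D|) * k := by nlinarith [sq_nonneg c]
    _ = C * k := by ring

theorem mainTheorem10 (K c D : ℝ) (hc : 1 ≤ c) (q d : ℕ) :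
    ∃ (C : ℝ) (A : ℕ → ℝ → ℝ → LocalAlgorithm), 0 < C ∧
      ∀ n : ℕ, 2 ≤ n →
      ∀ G : SimpleGraph (Fin n), G ≠ ⊥ →
      ∀ ident : Fin n → ℕ, Function.Injective ident → (∀ v, ident v < n ^ q) →
      ∀ a : ℝ, a ≤ c * G.arboricity → (G.arboricity : ℝ) ≤ c * a →
        -- the tradeoff with parameter `t`
        (∀ t : ℝ, 2 < t → t ≤ K * √((n : ℝ) / Real.logb 2 n) →
          (A n a t).Colors G ident
            ⌊C * (t * G.arboricity * Real.logb 2 n)⌋₊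
            (C * (Real.logb t n + logStar n))
            (1 / (n : ℝ) ^ d)) ∧
        -- the choice `t = n ^ (1 / k)`
        (∀ k : ℝ, 0 < k → 2 < (n : ℝ) ^ (1 / k) →
          (n : ℝ) ^ (1 / k) ≤ K * √((n : ℝ) / Real.logb 2 n) →
          (A n a ((n : ℝ) ^ (1 / k))).Colors G ident
            ⌊C * (G.arboricity * (n : ℝ) ^ (1 / k) * Real.logb 2 n)⌋₊
            (C * (k + logStar n))
            (1 / (n : ℝ) ^ d) ∧
          ((logStar n : ℝ) ≤ D * k →
            (A n a ((n : ℝ) ^ (1 / k))).Colors G ident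
              ⌊C * (G.arboricity * (n : ℝ) ^ (1 / k) * Real.logb 2 n)⌋₊
              (C * k)
              (1 / (n : ℝ) ^ d))) := by
  obtain ⟨C, A, C_pos, hA⟩ := mainTheorem10_general D hc d
  refine ⟨C, A, C_pos, fun n hn G hG ident hident _ a ha ha' => ?_⟩
  obtain ⟨tradeoff, choice⟩ := hA hG hident ha ha' (Fintype.card_fin n)
  have hs : (1 : ℝ) ≤ logStar n := by exact_mod_cast one_le_logStar hn
  exact ⟨fun t ht _ => (tradeoff t ht).mono le_rfl (by gcongr) le_rfl, fun k hk ht _ =>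
    ⟨(choice k hk ht).1.mono le_rfl (by gcongr) le_rfl, fun hD => (choice k hk ht).2 (hs.trans hD)⟩⟩
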